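/- Let $\Gamma$ be a nonelementary (that is, not virtually cyclic) word-hyperbolic group, and let $S$ be a finite generating set of $\Gamma$. For $\gamma\in\Gamma$ let $\|\gamma\|$ be the smallest length of a word in $S\cup S^{-1}$ representing $\gamma$, let $d_S(\gamma,\gamma')=\|\gamma^{-1}\gamma'\|$ be the associated word metric, and let $B_{d_S}(e,n)=\{\gamma\in\Gamma : \|\gamma\|\le n\}$. Let $Z^{\rm virt}(\Gamma)$ be the virtual center of $\Gamma$, that is, the subgroup of the elements having only finitely many conjugates in $\Gamma$, and let $\mathfrak K$ be the conjugacy class of an element of $\Gamma- Z^{\rm virt}(\Gamma)$. Then $$ \limsup_{n\to+\infty}\frac1n\log \operatorname{Card}\big(\mathfrak K\cap B_{d_S}(e,n)\big)=\frac12\,\limsup_{n\to+\infty}\frac1n\log\operatorname{Card} B_{d_S}(e,n). $$ -/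

import Mathlib

namespace WordHyp

variable {G : Type*} [Group G]

/-- Words in `S ∪ S⁻¹` of length `n` that represent `g`: the predicate that one exists. -/
def IsRepresentedBy (S : Set G) (g : G) (n : ℕ) : Prop :=
  ∃ l : List G, l.length = n ∧ (∀ a ∈ l, a ∈ S ∨ a⁻¹ ∈ S) ∧ l.prod = g

/-- The word norm `‖g‖`: the smallest length of a word in `S ∪ S⁻¹` representing `g`
(used only for generating sets `S`, where such a word always exists). -/
noncomputable def wordNorm (S : Set G) (g : G) : ℕ :=
  sInf {n : ℕ | IsRepresentedBy S g n}

/-- The left-invariant word metric `d_S(g, h) = ‖g⁻¹ h‖`. -/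
noncomputable def wordDist (S : Set G) (g h : G) : ℕ :=
  wordNorm S (g⁻¹ * h)

/-- The closed ball of radius `n` centred at the identity for the word metric. -/
def ball (S : Set G) (n : ℕ) : Set G :=
  {g : G | wordDist S 1 g ≤ n}

/-- The Gromov product `(x | y)_w` for the word metric. -/
noncomputable def gromovProduct (S : Set G) (x y w : G) : ℝ :=
  ((wordDist S x w : ℝ) + (wordDist S y w : ℝ) - (wordDist S x y : ℝ)) / 2

/-- A group is word-hyperbolic if, for some finite generating set, its word metric is
Gromov-hyperbolic (for some constant `δ`). -/
def IsWordHyperbolic (G : Type*) [Group G] : Prop :=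
  ∃ T : Set G, T.Finite ∧ Subgroup.closure T = ⊤ ∧
    ∃ δ : ℝ, ∀ x y z w : G,
      min (gromovProduct T x y w) (gromovProduct T y z w) - δ ≤ gromovProduct T x z w

/-- A word-hyperbolic group is elementary if it is virtually cyclic (finite groups included). -/
def IsNonelementary (G : Type*) [Group G] : Prop :=
  ¬ ∃ H : Subgroup G, H.FiniteIndex ∧ IsCyclic H

/-- The virtual center: the subgroup of the elements that have finitely many conjugates. -/
def virtualCenter (G : Type*) [Group G] : Subgroup G where
  carrier := {g : G | (conjugatesOf g).Finite}
  one_mem' := by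
    refine (Set.finite_singleton (1 : G)).subset ?_
    intro b hb
    exact (isConj_one_right.mp hb)
  mul_mem' := by
    intro a b ha hb
    refine (Set.Finite.image2 (fun x y : G => x * y) ha hb).subset ?_
    intro c hc
    obtain ⟨u, rfl⟩ := isConj_iff.mp hc
    exact ⟨u * a * u⁻¹, isConj_iff.mpr ⟨u, rfl⟩, u * b * u⁻¹, isConj_iff.mpr ⟨u, rfl⟩,
      by group⟩
  inv_mem' := by
    intro a ha
    refine (Set.Finite.image (fun x : G => x⁻¹) ha).subset ?_
    intro c hc
    obtain ⟨u, rfl⟩ := isConj_iff.mp hc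
    exact ⟨u * a * u⁻¹, isConj_iff.mpr ⟨u, rfl⟩, by group⟩

/-- The exponential growth rate `limsup (1/n) log Card (A ∩ B(e, n))` of a subset `A`, as an
extended real number, so that the upper limit is taken without a boundedness condition. -/
noncomputable def growthRate (S A : Set G) : EReal :=
  Filter.limsup
    (fun n : ℕ => (((1 / (n : ℝ)) * Real.log ((A ∩ ball S n).ncard : ℝ) : ℝ) : EReal))
    Filter.atTop

end WordHyp

namespace WordHyp

/-! Both bounds compare the conjugacy class with balls of half the radius. Upper bound: in a
hyperbolic metric, `g = w * γ * w⁻¹` moves the midpoint of `1` and `g` by a bounded amount, so `g`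
is conjugate to `γ` by an element near that midpoint (`exists_conj_dist_le`). Hyperbolicity is given
for `T` only, but an `S`-geodesic stays logarithmically close to `T`-geodesics, so the conjugator
has `S`-length `‖g‖ / 2 + O(log ‖g‖)` (`exists_conj_wordNorm_le`). Lower bound: finitely many
conjugates of `γ` suffice for no direction to be almost fixed by all of them
(`exists_conj_gromov_le`). Choosing `c g` that moves the direction of `g⁻¹`, `g` is near the
midpoint of `1` and `g * c g * g⁻¹`, so this map has bounded fibers (`exists_bounded_fibers`). Ball
growth is a true limit by subadditivity, so passing to radius `n / 2 + o(n)` halves it. -/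

/-- A left-invariant proper metric on a group that satisfies the four-point condition with
constant `δ` and in which points can be found at any prescribed distance (up to `1`) between two
given points. -/
structure IsHyperbolicMetric {G : Type*} [Group G] (d : G → G → ℝ) (δ : ℝ) : Prop where
  self : ∀ x, d x x = 0
  nonneg : ∀ x y, 0 ≤ d x y
  symm : ∀ x y, d x y = d y x
  tri : ∀ x y z, d x z ≤ d x y + d y z
  inv : ∀ g x y, d (g * x) (g * y) = d x y
  four : ∀ x y z w, d x z + d y w ≤ d x y + d z w + 2 * δ ∨ d x z + d y w ≤ d y z + d x w + 2 * δ
  between : ∀ x y t, 0 ≤ t → t ≤ d x y → ∃ m, d x m ≤ t ∧ t ≤ d x m + 1 ∧ d x m + d m y = d x y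
  proper : ∀ r, {g | d 1 g ≤ r}.Finite

/-! ### Displacement and conjugators in a hyperbolic metric -/

namespace IsHyperbolicMetric

variable {G : Type*} [Group G] {d : G → G → ℝ} {δ : ℝ}

theorem delta_nonneg (h : IsHyperbolicMetric d δ) : 0 ≤ δ := by
  have := h.four 1 1 1 1
  have := h.self 1
  grind

theorem dist_mul_inv_left (h : IsHyperbolicMetric d δ) (g x : G) : d g x = d 1 (g⁻¹ * x) := by
  rw [← h.inv g⁻¹ g x, inv_mul_cancel]

theorem dist_one_inv (h : IsHyperbolicMetric d δ) (g : G) : d 1 g⁻¹ = d 1 g := by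
  rw [h.symm, ← h.inv g g⁻¹ 1, mul_inv_cancel, mul_one]

theorem dist_pow_le (h : IsHyperbolicMetric d δ) (c y : G) (n : ℕ) :
    d y (c ^ n * y) ≤ n * d y (c * y) := by
  induction n with
  | zero => simp [h.self]
  | succ n ih =>
    have h1 := h.tri y (c ^ n * y) (c ^ (n + 1) * y)
    have h2 : d (c ^ n * y) (c ^ (n + 1) * y) = d y (c * y) := by
      rw [pow_succ, mul_assoc, h.inv]
    push_cast
    linarith

/-- The displacement of the square of an isometry exceeds the displacement of the isometry by
at most the displacement at any other point. -/
theorem dist_sq_le (h : IsHyperbolicMetric d δ) (c x y : G) :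
    d x (c * (c * x)) ≤ d x (c * x) + d y (c * y) + 2 * δ := by
  by_contra! hlt
  set a : ℕ → ℝ := fun n => d x (c ^ n * x) with ha
  have hδ := h.delta_nonneg
  have ha1 : a 1 = d x (c * x) := by simp [ha]
  have ha2 : a 2 = d x (c * (c * x)) := by simp [ha, pow_two, mul_assoc]
  -- If the claim fails, the four-point condition makes orbit distances grow by at least `κ` per
  -- step, while through `y` they grow at rate at most `d y (c * y) < κ`.
  set κ := a 2 - a 1 - 2 * δ with hκ
  have hκpos : d y (c * y) < κ := by linarith
  have hL := h.nonneg y (c * y)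
  have shift : ∀ i j, d (c ^ i * x) (c ^ (i + j) * x) = a j := by
    intro i j
    rw [pow_add, mul_assoc, h.inv]
  have step : ∀ n, a (n + 1) + κ ≤ a (n + 2) := by
    intro n
    induction n with
    | zero => simp only [zero_add]; linarith
    | succ n ih =>
      have h4 := h.four x (c ^ 1 * x) (c ^ 2 * x) (c ^ (n + 3) * x)
      have e1 : d (c ^ 1 * x) (c ^ (n + 3) * x) = a (n + 2) := by
        rw [← shift 1 (n + 2)]; congr 3; omega
      have e2 : d (c ^ 2 * x) (c ^ (n + 3) * x) = a (n + 1) := by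
        rw [← shift 2 (n + 1)]; congr 3; omega
      have e3 : d (c ^ 1 * x) (c ^ 2 * x) = a 1 := shift 1 1
      rw [e1, e2, e3] at h4
      change a 2 + a (n + 2) ≤ a 1 + a (n + 1) + 2 * δ ∨
        a 2 + a (n + 2) ≤ a 1 + a (n + 3) + 2 * δ at h4
      change a (n + 2) + κ ≤ a (n + 3)
      rcases h4 with h4 | h4 <;> linarith
  have lower : ∀ n : ℕ, n * κ ≤ a (n + 1) := by
    intro n
    induction n with
    | zero => simpa using h.nonneg _ _
    | succ n ih =>
      have := step n
      push_cast
      linarith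
  have upper : ∀ n : ℕ, a n ≤ 2 * d x y + n * d y (c * y) := by
    intro n
    have h1 := h.tri x y (c ^ n * x)
    have h2 := h.tri y (c ^ n * y) (c ^ n * x)
    have h3 := h.dist_pow_le c y n
    rw [h.inv, h.symm y x] at h2
    linarith
  obtain ⟨n, hn⟩ := exists_nat_gt ((2 * d x y + d y (c * y)) / (κ - d y (c * y)))
  rw [div_lt_iff₀ (by linarith)] at hn
  have h1 := lower n
  have h2 := upper (n + 1)
  push_cast at h2
  linarith

/-- The midpoint of `x` and `c x` is moved by `c` by about the displacement at any point. -/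
theorem dist_midpoint_le (h : IsHyperbolicMetric d δ) {c x m : G} (y : G)
    (h1 : d x m ≤ d x (c * x) / 2) (h2 : d x (c * x) / 2 ≤ d x m + 1)
    (h3 : d x m + d m (c * x) = d x (c * x)) :
    d m (c * m) ≤ d y (c * y) + 6 * δ + 4 := by
  have hδ := h.delta_nonneg
  have h4 := h.dist_sq_le c x y
  have hy := h.nonneg y (c * y)
  have e1 := h.inv c x m
  have e2 := h.inv c m (c * x)
  have e3 := h.inv c x (c * x)
  -- `f1` and `dist_sq_le` bound `d m (c * (c * x))`; `f2` then compares `m` and `c * m`, midpoints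
  -- of consecutive segments of the orbit.
  have f1 := h.four (c * (c * x)) x m (c * x)
  have f2 := h.four m (c * x) (c * m) (c * (c * x))
  have s1 := h.symm (c * (c * x)) m
  have s2 := h.symm (c * (c * x)) x
  have s3 := h.symm (c * (c * x)) (c * x)
  rcases f1 with f1 | f1 <;> rcases f2 with f2 | f2 <;> linarith

/-- Every conjugate `g` of `γ` is conjugate to it by an element of length about half of that
of `g`. -/
theorem exists_conj_dist_le (h : IsHyperbolicMetric d δ) (γ : G) :
    ∃ C, ∀ g ∈ conjugatesOf γ, ∃ u, g = u * γ * u⁻¹ ∧ d 1 u ≤ d 1 g / 2 + C := by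
  have hv : ∀ k : G, ∃ v : G, k ∈ conjugatesOf γ → k = v * γ * v⁻¹ := by
    intro k
    by_cases hk : k ∈ conjugatesOf γ
    · obtain ⟨v, hv⟩ := isConj_iff.mp hk
      exact ⟨v, fun _ => hv.symm⟩
    · exact ⟨1, fun h => absurd h hk⟩
  choose v hv using hv
  -- Translating the midpoint of `1` and `g` to `1` turns `g` into a conjugate in this finite ball,
  -- where conjugators have bounded length.
  obtain ⟨C, hC⟩ := ((h.proper (d 1 γ + 6 * δ + 4)).image (fun k => d 1 (v k))).bddAbove
  refine ⟨C, fun g hg => ?_⟩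
  have hpos := h.nonneg 1 g
  obtain ⟨m, h1, h2, h3⟩ := h.between 1 g (d 1 g / 2) (by linarith) (by linarith)
  obtain ⟨w, hw⟩ := isConj_iff.mp hg
  have hk : m⁻¹ * g * m ∈ conjugatesOf γ :=
    isConj_iff.mpr ⟨m⁻¹ * w, by rw [← hw]; group⟩
  have hmid := h.dist_midpoint_le (c := g) (x := 1) (m := m) w
    (by simpa using h1) (by simpa using h2) (by simpa using h3)
  have ew : d w (g * w) = d 1 γ := by
    rw [h.dist_mul_inv_left, ← hw]; congr 1; group
  have em : d m (g * m) = d 1 (m⁻¹ * g * m) := by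
    rw [h.dist_mul_inv_left, mul_assoc]
  have hvk : d 1 (v (m⁻¹ * g * m)) ≤ C :=
    hC ⟨m⁻¹ * g * m, by simp only [Set.mem_ofPred_eq]; linarith, rfl⟩
  refine ⟨m * v (m⁻¹ * g * m), ?_, ?_⟩
  · have e : m * v (m⁻¹ * g * m) * γ * (m * v (m⁻¹ * g * m))⁻¹ =
        m * (v (m⁻¹ * g * m) * γ * (v (m⁻¹ * g * m))⁻¹) * m⁻¹ := by group
    rw [e, ← hv _ hk]
    group
  · have t := h.tri 1 m (m * v (m⁻¹ * g * m))
    have e := h.inv m 1 (v (m⁻¹ * g * m))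
    rw [mul_one] at e
    linarith

/-! ### Gromov products and directions moved by conjugates -/

/-- Along a path of at most `2 ^ j` steps the Gromov product drops by at most `j * δ`. -/
theorem le_gromov_of_path (h : IsHyperbolicMetric d δ) (w : G) (B : ℝ) (y : ℕ → G)
    (hy : ∀ i, B ≤ (d (y i) w + d (y (i + 1)) w - d (y i) (y (i + 1))) / 2) (j : ℕ) :
    ∀ a k : ℕ, 1 ≤ k → k ≤ 2 ^ j →
      B - j * δ ≤ (d (y a) w + d (y (a + k)) w - d (y a) (y (a + k))) / 2 := by
  have hδ := h.delta_nonneg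
  induction j with
  | zero =>
    intro a k h1 h2
    obtain rfl : k = 1 := by simp at h2; omega
    simpa using hy a
  | succ j ih =>
    intro a k h1 h2
    rw [pow_succ] at h2
    push_cast
    rcases le_or_gt k (2 ^ j) with hk | hk
    · have := ih a k h1 hk
      linarith
    · have i1 := ih a (2 ^ j) Nat.one_le_two_pow le_rfl
      have i2 := ih (a + 2 ^ j) (k - 2 ^ j) (by omega) (by omega)
      rw [show a + 2 ^ j + (k - 2 ^ j) = a + k by omega] at i2
      have f := h.four (y a) (y (a + 2 ^ j)) (y (a + k)) w
      rcases f with f | f <;> linarith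

/-- If `c` moves the far point `x` little as seen from `1`, then it moves a point `p` at
intermediate distance between `1` and `x` by about its displacement at any point `y`. -/
theorem dist_le_of_gromov_large (h : IsHyperbolicMetric d δ) {c x p : G} (y : G) {R t N : ℝ}
    (hR : d 1 c ≤ R) (ht : 2 * R + 2 * δ + 1 ≤ t) (hN : 2 * t + 6 * R + 4 * δ + 4 ≤ N)
    (hx : N < (d 1 x + d 1 (c * x) - d x (c * x)) / 2)
    (hp1 : d 1 p ≤ t + 1) (hp2 : t ≤ d 1 p) (hp : d 1 p + d p x = d 1 x) :
    d p (c * p) ≤ d y (c * y) + 16 * δ := by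
  have hδ := h.delta_nonneg
  have hc := h.nonneg 1 c
  -- An isometry that moves `1` little and almost keeps the direction of `x` sends `p` close to a
  -- geodesic from `1` to `x`.
  have near : ∀ b : G, d 1 b ≤ 2 * R →
      N - R - δ < (d 1 x + d 1 (b * x) - d x (b * x)) / 2 →
      d 1 (b * p) + d (b * p) x ≤ d 1 x + 4 * δ := by
    intro b hb hbx
    have e1 := h.inv b 1 p
    have e2 := h.inv b p x
    have e3 := h.inv b 1 x
    rw [mul_one] at e1 e3
    have f1 := h.four b 1 (b * x) (b * p)
    have f2 := h.four 1 x (b * x) (b * p)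
    have s1 := h.symm b 1
    have s2 := h.symm (b * x) (b * p)
    have s3 := h.symm x (b * p)
    have t1 := h.tri b 1 (b * p)
    have t2 := h.tri 1 b (b * p)
    have t3 := h.tri 1 (b * p) x
    have t4 := h.tri 1 (b * p) (b * x)
    rcases f1 with f1 | f1 <;> rcases f2 with f2 | f2 <;> linarith
  have hc1 := near c (by linarith) (by linarith)
  have hcc : d 1 (c * c) ≤ 2 * R := by
    have t1 := h.tri 1 c (c * c)
    have e := h.inv c 1 c
    rw [mul_one] at e
    linarith
  have ecx := h.inv c 1 x
  have ecp := h.inv c 1 p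
  rw [mul_one] at ecx ecp
  have hccx : N - R - δ < (d 1 x + d 1 (c * c * x) - d x (c * c * x)) / 2 := by
    rw [mul_assoc]
    have f := h.four x (c * x) (c * (c * x)) 1
    have e1 := h.inv c x (c * x)
    have e2 := h.inv c 1 (c * x)
    rw [mul_one] at e2
    have s1 := h.symm x 1
    have s2 := h.symm (c * x) 1
    have s3 := h.symm (c * (c * x)) 1
    have s4 := h.symm c 1
    have t1 := h.tri c 1 (c * (c * x))
    have t2 := h.tri c 1 (c * x)
    rcases f with f | f <;> linarith
  have hc2 := near (c * c) hcc hccx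
  rw [mul_assoc] at hc2
  have sq := h.dist_sq_le c p y
  have a1 := h.four 1 p x (c * p)
  have a2 := h.four (c * p) (c * x) x (c * (c * p))
  have a3 := h.four (c * p) x (c * x) (c * (c * p))
  have e1 := h.inv c p x
  have e2 := h.inv c x (c * p)
  have e3 := h.inv c p (c * p)
  have s1 := h.symm x (c * p)
  have s2 := h.symm x (c * (c * p))
  have s3 := h.symm x (c * x)
  have s4 := h.symm p 1
  have t1 := h.tri x p (c * (c * p))
  have t2 := h.tri p (c * (c * p)) x
  have t3 := h.tri p 1 (c * p)
  have t4 := h.tri 1 c (c * p)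
  have t5 := h.tri 1 (c * p) x
  have t6 := h.tri 1 c (c * x)
  have s6 := h.symm p x
  -- The distances to `x` from `p`, `c * p`, `c * (c * p)` form an arithmetic progression up to `2 *
  -- δ`. Hence `d p (c * (c * p))` is at least about `2 * d p (c * p)`, and `sq` bounds the latter.
  have b3 : |d (c * p) x + d (c * x) (c * (c * p)) - d (c * p) (c * x) - d x (c * (c * p))|
      ≤ 2 * δ := by
    rw [abs_le]
    constructor
    · rcases a3 with f | f <;> linarith
    · rcases a2 with f | f <;> linarith
  rw [abs_le] at b3
  obtain ⟨b3, b4⟩ := b3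
  rcases a1 with f | f <;> linarith

/-- If `γ` has infinitely many conjugates, then no direction is almost fixed by all short
conjugates of `γ`. -/
theorem exists_conj_gromov_le (h : IsHyperbolicMetric d δ) {γ : G}
    (hγ : (conjugatesOf γ).Infinite) :
    ∃ R, ∀ x, ∃ c ∈ conjugatesOf γ, d 1 c ≤ R ∧
      (d 1 x + d 1 (c * x) - d x (c * x)) / 2 ≤ R := by
  have hδ := h.delta_nonneg
  have hfin := h.proper (d 1 γ + 16 * δ)
  -- Pigeonhole: if all of `F` almost fixed one direction, conjugation by a suitable `p` would embed
  -- `F` in a ball with fewer elements.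
  obtain ⟨F, hF, hcard⟩ := hγ.exists_subset_card_eq (hfin.toFinset.card + 1)
  obtain ⟨R, hR⟩ := (F.finite_toSet.image (fun c => d 1 c)).bddAbove
  have hR' : ∀ c ∈ F, d 1 c ≤ R := fun c hc => hR ⟨c, hc, rfl⟩
  obtain ⟨c₀, hc₀⟩ : F.Nonempty := by
    rw [← Finset.card_pos]; omega
  have hR0 : 0 ≤ R := (h.nonneg 1 c₀).trans (hR' c₀ hc₀)
  set t := 2 * R + 2 * δ + 1 with ht
  set N := 2 * (t + 1) + 6 * R + 4 * δ + 4 with hN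
  by_contra! hcon
  obtain ⟨x, hx⟩ := hcon N
  have hxc : ∀ c ∈ F, N < (d 1 x + d 1 (c * x) - d x (c * x)) / 2 := fun c hc =>
    hx c (hF hc) ((hR' c hc).trans (by linarith))
  have hlen : t + 1 ≤ d 1 x := by
    have h1 := hxc c₀ hc₀
    have h2 := h.tri 1 x (c₀ * x)
    linarith
  -- `between` may undershoot by `1`, so `t + 1` is requested to ensure `t ≤ d 1 p`.
  obtain ⟨p, hp1, hp2, hp3⟩ := h.between 1 x (t + 1) (by linarith) hlen
  have key : ∀ c ∈ F, p⁻¹ * c * p ∈ hfin.toFinset := by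
    intro c hc
    obtain ⟨w, hw⟩ := isConj_iff.mp (hF hc)
    have h1 := h.dist_le_of_gromov_large (p := p) (t := t) w (hR' c hc) ht.ge (by linarith)
      (hxc c hc) hp1 (by linarith) hp3
    rw [h.dist_mul_inv_left p, h.dist_mul_inv_left w, ← mul_assoc, ← mul_assoc] at h1
    have e : w⁻¹ * c * w = γ := by rw [← hw]; group
    rw [e] at h1
    simpa using h1
  have := Finset.card_le_card_of_injOn _ key (by
    intro a _ b _ hab
    simpa using hab)
  omega

/-- If `γ` has infinitely many conjugates, then one can select, among finitely many conjugates
of `γ`, for each `g` a conjugate `c g` such that `g ↦ g * c g * g⁻¹` has bounded fibers. -/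
theorem exists_bounded_fibers (h : IsHyperbolicMetric d δ) {γ : G}
    (hγ : (conjugatesOf γ).Infinite) :
    ∃ (F : Set G) (Q : ℕ) (c : G → G), F.Finite ∧ (∀ g, c g ∈ F) ∧
      (∀ g, c g ∈ conjugatesOf γ) ∧
      ∀ b, ∀ A : Finset G, (∀ g ∈ A, g * c g * g⁻¹ = b) → A.card ≤ Q := by
  obtain ⟨R, hR⟩ := h.exists_conj_gromov_le hγ
  choose c hc1 hc2 hc3 using hR
  have hfin := h.proper (4 * R + 2 * δ)
  refine ⟨{g | d 1 g ≤ R}, hfin.toFinset.card, fun g => c g⁻¹, h.proper R,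
    fun g => hc2 _, fun g => hc1 _, fun b A hA => ?_⟩
  rcases A.eq_empty_or_nonempty with rfl | ⟨g₀, hg₀⟩
  · simp
  -- Here `d 1 b = d g⁻¹ (c g⁻¹ * g⁻¹)`, so a small Gromov product puts `g` near the midpoint of `1`
  -- and `b`; any two such points are within `4 * R + 2 * δ`.
  have key : ∀ g ∈ A, 2 * d 1 g ≤ d 1 b + 3 * R ∧ d g b ≤ d 1 g + R := by
    intro g hg
    have e := hA g hg
    have e1 : d 1 b = d g⁻¹ (c g⁻¹ * g⁻¹) := by
      rw [h.dist_mul_inv_left g⁻¹, ← e]; congr 1; group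
    have e2 : d g b = d 1 (c g⁻¹ * g⁻¹) := by
      rw [h.dist_mul_inv_left, ← e]; congr 1; group
    have h2 := hc2 g⁻¹
    have h3 := hc3 g⁻¹
    have e3 := h.dist_one_inv g
    have e4 := h.inv (c g⁻¹) 1 g⁻¹
    rw [mul_one] at e4
    have t1 := h.tri 1 (c g⁻¹) (c g⁻¹ * g⁻¹)
    have t2 := h.tri (c g⁻¹) 1 (c g⁻¹ * g⁻¹)
    have s := h.symm (c g⁻¹) 1
    constructor <;> linarith
  refine Finset.card_le_card_of_injOn (fun g => g₀⁻¹ * g) ?_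
    (by intro a _ b _ hab; simpa using hab)
  intro g hg
  have k0 := key g₀ hg₀
  have k1 := key g hg
  have f := h.four g₀ 1 g b
  have s := h.symm g₀ 1
  have e := h.dist_mul_inv_left g₀ g
  simp only [Set.Finite.coe_toFinset, Set.mem_ofPred_eq]
  rcases f with f | f <;> linarith

end IsHyperbolicMetric

/-! ### Word norms and word metrics -/

section WordNorm

variable {G : Type*} [Group G] {S : Set G}

theorem IsRepresentedBy.mul {g h : G} {m n : ℕ} (hg : IsRepresentedBy S g m)
    (hh : IsRepresentedBy S h n) : IsRepresentedBy S (g * h) (m + n) := by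
  obtain ⟨l, rfl, hl, rfl⟩ := hg
  obtain ⟨l', rfl, hl', rfl⟩ := hh
  refine ⟨l ++ l', by simp, ?_, by simp⟩
  intro a ha
  rcases List.mem_append.mp ha with ha | ha
  exacts [hl a ha, hl' a ha]

theorem IsRepresentedBy.inv {g : G} {n : ℕ} (hg : IsRepresentedBy S g n) :
    IsRepresentedBy S g⁻¹ n := by
  obtain ⟨l, rfl, hl, rfl⟩ := hg
  refine ⟨(l.map (·⁻¹)).reverse, by simp, ?_, by rw [List.prod_inv_reverse]⟩
  intro a ha
  simp only [List.mem_reverse, List.mem_map] at ha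
  obtain ⟨b, hb, rfl⟩ := ha
  rw [inv_inv]
  exact (hl b hb).symm

theorem IsRepresentedBy.one : IsRepresentedBy S 1 0 := ⟨[], by simp⟩

theorem IsRepresentedBy.wordNorm_le {g : G} {n : ℕ} (hg : IsRepresentedBy S g n) :
    wordNorm S g ≤ n := Nat.sInf_le hg

theorem isRepresentedBy_wordNorm (hS : Subgroup.closure S = ⊤)
    (g : G) : IsRepresentedBy S g (wordNorm S g) := by
  have hex : ∃ n, IsRepresentedBy S g n := by
    have hg : g ∈ Subgroup.closure S := hS ▸ Subgroup.mem_top g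
    induction hg using Subgroup.closure_induction with
    | mem x hx => exact ⟨1, [x], by simp [hx]⟩
    | one => exact ⟨0, .one⟩
    | mul x y _ _ hx hy =>
      obtain ⟨m, hm⟩ := hx
      obtain ⟨n, hn⟩ := hy
      exact ⟨_, hm.mul hn⟩
    | inv x _ hx =>
      obtain ⟨m, hm⟩ := hx
      exact ⟨_, hm.inv⟩
  exact Nat.sInf_mem hex

theorem wordNorm_mul_le (hS : Subgroup.closure S = ⊤)
    (g h : G) : wordNorm S (g * h) ≤ wordNorm S g + wordNorm S h :=
  ((isRepresentedBy_wordNorm hS g).mul (isRepresentedBy_wordNorm hS h)).wordNorm_le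

theorem wordNorm_inv (hS : Subgroup.closure S = ⊤) (g : G) : wordNorm S g⁻¹ = wordNorm S g := by
  have key : ∀ g : G, wordNorm S g⁻¹ ≤ wordNorm S g := fun g =>
    (isRepresentedBy_wordNorm hS g).inv.wordNorm_le
  exact le_antisymm (key g) (by simpa using key g⁻¹)

theorem wordNorm_one : wordNorm S (1 : G) = 0 :=
  Nat.le_zero.mp IsRepresentedBy.one.wordNorm_le

theorem exists_mul_wordNorm_eq (hS : Subgroup.closure S = ⊤)
    (g : G) {i : ℕ} (hi : i ≤ wordNorm S g) :
    ∃ a b, g = a * b ∧ wordNorm S a = i ∧ i + wordNorm S b = wordNorm S g := by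
  obtain ⟨l, hl, hl', hg⟩ := isRepresentedBy_wordNorm hS g
  have ha : wordNorm S (l.take i).prod ≤ i :=
    IsRepresentedBy.wordNorm_le
      ⟨l.take i, by simp; omega, fun a ha => hl' a (List.mem_of_mem_take ha), rfl⟩
  have hb : wordNorm S (l.drop i).prod ≤ wordNorm S g - i :=
    IsRepresentedBy.wordNorm_le
      ⟨l.drop i, by simp; omega, fun a ha => hl' a (List.mem_of_mem_drop ha), rfl⟩
  have hab : g = (l.take i).prod * (l.drop i).prod := by rw [List.prod_take_mul_prod_drop, hg]
  have := wordNorm_mul_le hS (l.take i).prod (l.drop i).prod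
  rw [← hab] at this
  exact ⟨_, _, hab, by omega, by omega⟩

/-- Used in both directions to compare `S` with the generating set whose metric is known to be
hyperbolic. -/
theorem exists_wordNorm_le_mul (hS : Subgroup.closure S = ⊤) {T : Set G}
    (hT : Subgroup.closure T = ⊤) (hTfin : T.Finite) :
    ∃ M : ℕ, ∀ g, wordNorm S g ≤ M * wordNorm T g := by
  obtain ⟨M, hM⟩ := (hTfin.image (wordNorm S)).bddAbove
  have key : ∀ l : List G, (∀ a ∈ l, a ∈ T ∨ a⁻¹ ∈ T) → wordNorm S l.prod ≤ M * l.length := by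
    intro l
    induction l with
    | nil => intro _; simp [wordNorm_one]
    | cons a l ih =>
      intro hl
      have h1 := ih (fun b hb => hl b (List.mem_cons_of_mem _ hb))
      have h2 : wordNorm S a ≤ M := by
        rcases hl a List.mem_cons_self with ha | ha
        · exact hM ⟨a, ha, rfl⟩
        · rw [← wordNorm_inv hS]; exact hM ⟨_, ha, rfl⟩
      have h3 := wordNorm_mul_le hS a l.prod
      rw [List.prod_cons, List.length_cons, mul_add]
      omega
  refine ⟨M, fun g => ?_⟩
  obtain ⟨l, hl, hl', rfl⟩ := isRepresentedBy_wordNorm hT g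
  rw [← hl]
  exact key l hl'

theorem ball_add (hS : Subgroup.closure S = ⊤)
    (m n : ℕ) : ball S (m + n) ⊆ Set.image2 (· * ·) (ball S m) (ball S n) := by
  intro g hg
  simp only [ball, wordDist, inv_one, one_mul, Set.mem_ofPred_eq, Set.mem_image2] at hg ⊢
  obtain ⟨a, b, hab, ha, hb⟩ := exists_mul_wordNorm_eq hS g (min_le_left (wordNorm S g) m)
  exact ⟨a, by omega, b, by omega, hab.symm⟩

theorem finite_ball (hS : Subgroup.closure S = ⊤) (hfin : S.Finite) (n : ℕ) : (ball S n).Finite := by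
  have hU : (S ∪ S⁻¹).Finite := hfin.union hfin.inv
  have : Finite ↥(S ∪ S⁻¹) := hU
  refine (Set.Finite.image (fun l : List ↥(S ∪ S⁻¹) => (l.map Subtype.val).prod)
    (List.finite_length_le ↥(S ∪ S⁻¹) n)).subset ?_
  intro g hg
  simp only [ball, wordDist, inv_one, one_mul, Set.mem_ofPred_eq] at hg
  obtain ⟨l, hl, hl', rfl⟩ := isRepresentedBy_wordNorm hS g
  lift l to List ↥(S ∪ S⁻¹) using fun a ha => by simpa using hl' a ha
  refine ⟨l, ?_, rfl⟩
  simp only [List.length_map] at hl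
  simp only [Set.mem_ofPred_eq]
  omega

theorem isHyperbolicMetric_wordDist (hS : Subgroup.closure S = ⊤) (hfin : S.Finite)
    {δ : ℝ} (hδ : ∀ x y z w : G, min (gromovProduct S x y w) (gromovProduct S y z w) - δ ≤
      gromovProduct S x z w) :
    IsHyperbolicMetric (fun x y : G => (wordDist S x y : ℝ)) δ where
  self x := by simp [wordDist, wordNorm_one]
  nonneg x y := Nat.cast_nonneg _
  symm x y := by
    simp only [wordDist]
    rw [← wordNorm_inv hS]
    simp
  tri x y z := by
    have := wordNorm_mul_le hS (x⁻¹ * y) (y⁻¹ * z)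
    rw [show x⁻¹ * y * (y⁻¹ * z) = x⁻¹ * z by group] at this
    exact_mod_cast this
  inv g x y := by
    simp only [wordDist]
    congr 2
    group
  four x y z w := by
    have h1 := hδ x y z w
    simp only [gromovProduct] at h1
    rcases min_cases (((wordDist S x w : ℝ) + wordDist S y w - wordDist S x y) / 2)
      (((wordDist S y w : ℝ) + wordDist S z w - wordDist S y z) / 2) with ⟨e, _⟩ | ⟨e, _⟩ <;>
      rw [e] at h1
    · left; linarith
    · right; linarith
  between x y t ht1 ht2 := by
    -- A geodesic word can be cut only at integers, hence the error `1` in `between`.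
    have hfl : ⌊t⌋₊ ≤ wordNorm S (x⁻¹ * y) := by
      have := Nat.floor_le_floor ht2
      rwa [Nat.floor_natCast] at this
    obtain ⟨a, b, hab, ha, hb⟩ := exists_mul_wordNorm_eq hS (x⁻¹ * y) hfl
    refine ⟨x * a, ?_, ?_, ?_⟩
    · simpa [wordDist, ha] using Nat.floor_le ht1
    · simpa [wordDist, ha] using (Nat.lt_floor_add_one t).le
    · have e : (x * a)⁻¹ * y = b := by rw [mul_inv_rev, mul_assoc, hab]; group
      simp only [wordDist, e]
      rw [← hb, inv_mul_cancel_left, ha]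
      push_cast
      ring
  proper r := by
    refine (finite_ball hS hfin ⌊r⌋₊).subset ?_
    intro g hg
    exact Nat.le_floor hg

end WordNorm
-- Counting conjugates against balls
section Counting

variable {G : Type*} [Group G] {S : Set G} {d : G → G → ℝ} {δ : ℝ}

theorem mem_ball {n : ℕ} {g : G} : g ∈ ball S n ↔ wordNorm S g ≤ n := by
  simp [ball, wordDist]

/-- Every conjugate `g` of `γ` is conjugate to it by an element whose `S`-length is half of that
of `g` up to a logarithmic error, even if the hyperbolic metric `d` is not the word metric
of `S`. -/
theorem exists_conj_wordNorm_le (h : IsHyperbolicMetric d δ) (hS : Subgroup.closure S = ⊤)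
    {M M' : ℝ} (hM : ∀ g, (wordNorm S g : ℝ) ≤ M * d 1 g)
    (hM' : ∀ g, d 1 g ≤ M' * wordNorm S g) (hM0 : 0 ≤ M) (hM0' : 0 ≤ M') (γ : G) :
    ∃ A : ℕ, ∀ g ∈ conjugatesOf γ, ∃ u, g = u * γ * u⁻¹ ∧
      2 * wordNorm S u ≤ wordNorm S g + A * (Nat.clog 2 (wordNorm S g + 1) + 1) := by
  have hδ := h.delta_nonneg
  obtain ⟨C, hC⟩ := h.exists_conj_dist_le γ
  -- The Gromov product of `1` and `g` at `u` is at most `C + d 1 γ / 2`. If every prefix of the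
  -- word were farther than `E + j * δ` from `u`, `le_gromov_of_path` would force it to be at least
  -- `E - M'`.
  set E := C + d 1 γ / 2 + M' + 1 with hE
  refine ⟨⌈|2 * (M * E) + wordNorm S γ|⌉₊ + ⌈2 * (M * δ)⌉₊, fun g hg => ?_⟩
  obtain ⟨u, hu, huC⟩ := hC g hg
  refine ⟨u, hu, ?_⟩
  set n := wordNorm S g with hn
  set j := Nat.clog 2 (n + 1) with hj
  obtain ⟨l, hl, hl', hlg⟩ := isRepresentedBy_wordNorm hS g
  have eu : u⁻¹ * g = γ * u⁻¹ := by rw [hu]; group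
  obtain ⟨i, hi⟩ : ∃ i, d u (l.take i).prod ≤ E + j * δ := by
    by_contra! hcon
    have step : ∀ i, d (l.take i).prod (l.take (i + 1)).prod ≤ M' := by
      intro i
      rw [h.dist_mul_inv_left]
      have h1 : IsRepresentedBy S ((l.take i).prod⁻¹ * (l.take (i + 1)).prod)
          (if i < l.length then 1 else 0) := by
        split_ifs with hi
        · rw [List.prod_take_succ _ _ hi, inv_mul_cancel_left]
          exact ⟨[l[i]], rfl, by simpa using hl' _ (List.getElem_mem hi), by simp⟩
        · rw [List.take_of_length_le (by omega), List.take_of_length_le (by omega),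
            inv_mul_cancel]
          exact .one
      have h2 : (wordNorm S ((l.take i).prod⁻¹ * (l.take (i + 1)).prod) : ℝ) ≤ 1 := by
        have := h1.wordNorm_le
        exact_mod_cast this.trans (by split_ifs <;> omega)
      exact (hM' _).trans (by nlinarith)
    -- The path is given `n + 1` steps, the last one constant, since the number of steps must be
    -- positive even if `n = 0`.
    have hpath := h.le_gromov_of_path u (E + j * δ - M') (fun i => (l.take i).prod) (by
      intro i
      have h1 := hcon i
      have h2 := step i
      have h3 := h.tri (l.take i).prod (l.take (i + 1)).prod u
      have s1 := h.symm u (l.take i).prod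
      linarith) j 0 (n + 1) (by omega) (Nat.le_pow_clog (by norm_num) _)
    simp only [List.take_zero, List.prod_nil, zero_add] at hpath
    rw [List.take_of_length_le (by omega), hlg] at hpath
    have h1 : d g u ≤ d 1 γ + d 1 u := by
      rw [h.symm, h.dist_mul_inv_left, eu, ← h.dist_one_inv u, ← h.inv γ 1 u⁻¹, mul_one]
      exact h.tri _ _ _
    linarith
  have hN : (wordNorm S (u⁻¹ * (l.take i).prod) : ℝ) ≤ M * (E + j * δ) :=
    (hM _).trans (mul_le_mul_of_nonneg_left (by rwa [← h.dist_mul_inv_left]) hM0)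
  have ha : wordNorm S (l.take i).prod ≤ min i l.length :=
    IsRepresentedBy.wordNorm_le
      ⟨l.take i, by simp, fun a ha => hl' a (List.mem_of_mem_take ha), rfl⟩
  have hb : wordNorm S (l.drop i).prod ≤ l.length - i :=
    IsRepresentedBy.wordNorm_le
      ⟨l.drop i, by simp, fun a ha => hl' a (List.mem_of_mem_drop ha), rfl⟩
  -- Prefix and suffix of the word each bound `‖u‖`, and their lengths add up to at most `n`; this
  -- gives the factor `2` in `k3`.
  have k1 : wordNorm S u ≤ wordNorm S (l.take i).prod + wordNorm S (u⁻¹ * (l.take i).prod) := by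
    rw [← wordNorm_inv hS (u⁻¹ * (l.take i).prod)]
    convert wordNorm_mul_le hS _ _ using 2
    group
  have k2 : wordNorm S u ≤ wordNorm S γ + (wordNorm S (u⁻¹ * (l.take i).prod) +
      wordNorm S (l.drop i).prod) := by
    have e : u⁻¹ = γ⁻¹ * (u⁻¹ * (l.take i).prod * (l.drop i).prod) := by
      rw [mul_assoc u⁻¹, List.prod_take_mul_prod_drop, hlg, eu]
      group
    have t1 := wordNorm_mul_le hS γ⁻¹ (u⁻¹ * (l.take i).prod * (l.drop i).prod)
    have t2 := wordNorm_mul_le hS (u⁻¹ * (l.take i).prod) (l.drop i).prod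
    rw [← e, wordNorm_inv hS, wordNorm_inv hS] at t1
    omega
  have k3 : 2 * wordNorm S u ≤ n + (wordNorm S γ + 2 * wordNorm S (u⁻¹ * (l.take i).prod)) := by
    omega
  have k4 : (2 * wordNorm S u : ℝ) ≤
      n + (wordNorm S γ + 2 * wordNorm S (u⁻¹ * (l.take i).prod)) := by exact_mod_cast k3
  have c1 := (le_abs_self _).trans (Nat.le_ceil |2 * (M * E) + wordNorm S γ|)
  have c2 := Nat.le_ceil (2 * (M * δ))
  have hj0 : (0 : ℝ) ≤ j := Nat.cast_nonneg _
  have p1 := mul_le_mul_of_nonneg_right c2 hj0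
  have p2 := mul_nonneg (Nat.cast_nonneg (α := ℝ) ⌈|2 * (M * E) + wordNorm S γ|⌉₊) hj0
  have p3 := Nat.cast_nonneg (α := ℝ) ⌈2 * (M * δ)⌉₊
  have : (2 * wordNorm S u : ℝ) ≤
      n + (⌈|2 * (M * E) + wordNorm S γ|⌉₊ + ⌈2 * (M * δ)⌉₊) * (j + 1) := by
    linarith
  exact_mod_cast this

/-- The map `u ↦ u * γ * u⁻¹` from the smaller ball covers the conjugates of length at most `n`. -/
theorem exists_ncard_conj_le (h : IsHyperbolicMetric d δ) (hS : Subgroup.closure S = ⊤)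
    (hfin : S.Finite) {M M' : ℝ} (hM : ∀ g, (wordNorm S g : ℝ) ≤ M * d 1 g)
    (hM' : ∀ g, d 1 g ≤ M' * wordNorm S g) (hM0 : 0 ≤ M) (hM0' : 0 ≤ M') (γ : G) :
    ∃ A : ℕ, ∀ n, (conjugatesOf γ ∩ ball S n).ncard ≤
      (ball S ((n + A * (Nat.clog 2 (n + 1) + 1)) / 2)).ncard := by
  obtain ⟨A, hA⟩ := exists_conj_wordNorm_le h hS hM hM' hM0 hM0' γ
  refine ⟨A, fun n => ?_⟩
  have hB := finite_ball hS hfin ((n + A * (Nat.clog 2 (n + 1) + 1)) / 2)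
  refine (Set.ncard_le_ncard ?_ (hB.image (fun u => u * γ * u⁻¹))).trans (Set.ncard_image_le hB)
  rintro g ⟨hg, hgn⟩
  rw [mem_ball] at hgn
  obtain ⟨u, hu, hun⟩ := hA g hg
  refine ⟨u, mem_ball.mpr ?_, hu.symm⟩
  have h1 : Nat.clog 2 (wordNorm S g + 1) ≤ Nat.clog 2 (n + 1) :=
    Nat.clog_mono_right 2 (by omega)
  have h2 := Nat.mul_le_mul_left A (Nat.add_le_add_right h1 1)
  omega

/-- The map `g ↦ g * c g * g⁻¹` at most doubles length up to a constant, and has fibers of size at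
most `Q`. -/
theorem exists_ncard_ball_le (h : IsHyperbolicMetric d δ) (hS : Subgroup.closure S = ⊤)
    (hfin : S.Finite) {γ : G} (hγ : (conjugatesOf γ).Infinite) :
    ∃ Q R : ℕ, ∀ r, (ball S r).ncard ≤ Q * (conjugatesOf γ ∩ ball S (2 * r + R)).ncard := by
  obtain ⟨F, Q, c, hF, hcF, hcγ, hQ⟩ := h.exists_bounded_fibers hγ
  obtain ⟨R, hR⟩ := (hF.image (wordNorm S)).bddAbove
  refine ⟨Q, R, fun r => ?_⟩
  classical
  have hB := finite_ball hS hfin r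
  have hK : (conjugatesOf γ ∩ ball S (2 * r + R)).Finite :=
    (finite_ball hS hfin _).subset Set.inter_subset_right
  rw [Set.ncard_eq_toFinset_card _ hB, Set.ncard_eq_toFinset_card _ hK]
  refine Finset.card_le_mul_card_image_of_maps_to (f := fun g => g * c g * g⁻¹) ?_ Q ?_
  · intro g hg
    rw [Set.Finite.mem_toFinset, mem_ball] at hg
    rw [Set.Finite.mem_toFinset]
    obtain ⟨w, hw⟩ := isConj_iff.mp (hcγ g)
    refine ⟨isConj_iff.mpr ⟨g * w, by rw [← hw]; group⟩, mem_ball.mpr ?_⟩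
    have h1 := wordNorm_mul_le hS (g * c g) g⁻¹
    have h2 := wordNorm_mul_le hS g (c g)
    have h3 : wordNorm S (c g) ≤ R := hR ⟨_, hcF g, rfl⟩
    rw [wordNorm_inv hS] at h1
    omega
  · intro b _
    exact hQ b _ (fun g hg => (Finset.mem_filter.mp hg).2)

end Counting

/-! ### Limits and growth rates -/

section Growth

open Filter Topology

/-- Write `v (r n) / n` as `v (r n) / r n` times `r n / n`, the second factor tending to `1 / 2`. -/
theorem tendsto_comp_div_of_ratio {v : ℕ → ℝ} {a : ℝ}
    (hv : Tendsto (fun n : ℕ => v n / n) atTop (𝓝 a)) {r : ℕ → ℕ} {e : ℕ → ℝ}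
    (hr : ∀ᶠ n : ℕ in atTop, |2 * (r n : ℝ) - n| ≤ e n)
    (he : Tendsto (fun n : ℕ => e n / n) atTop (𝓝 0)) :
    Tendsto (fun n : ℕ => v (r n) / n) atTop (𝓝 (a * (1 / 2))) := by
  have h1 : Tendsto (fun n : ℕ => (r n : ℝ) / n) atTop (𝓝 (1 / 2)) := by
    rw [tendsto_iff_dist_tendsto_zero]
    refine squeeze_zero' (Eventually.of_forall fun _ => dist_nonneg) ?_ he
    filter_upwards [hr, eventually_gt_atTop 0] with n hn hn0
    have hn0' : (0 : ℝ) < n := by exact_mod_cast hn0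
    rw [Real.dist_eq, show (r n : ℝ) / n - 1 / 2 = (2 * (r n : ℝ) - n) / 2 / n by field_simp,
      abs_div, abs_of_pos hn0', abs_div, abs_of_pos (two_pos : (0 : ℝ) < 2)]
    gcongr
    linarith [abs_nonneg (2 * (r n : ℝ) - n)]
  have h2 : Tendsto r atTop atTop := by
    have h3 := h1.pos_mul_atTop (by norm_num) (tendsto_natCast_atTop_atTop (R := ℝ))
    rw [← tendsto_natCast_atTop_iff (R := ℝ)]
    refine h3.congr' ?_
    filter_upwards [eventually_gt_atTop 0] with n hn
    have : (n : ℝ) ≠ 0 := by exact_mod_cast hn.ne'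
    field_simp
  refine ((hv.comp h2).mul h1).congr' ?_
  filter_upwards [h2.eventually_gt_atTop 0] with n hn
  have : (r n : ℝ) ≠ 0 := by exact_mod_cast hn.ne'
  simp only [Function.comp]
  field_simp

theorem tendsto_clog_div_atTop :
    Tendsto (fun n : ℕ => (Nat.clog 2 (n + 1) : ℝ) / n) atTop (𝓝 0) := by
  have h1 : Tendsto (fun n : ℕ => (Real.log n / n) * (2 / Real.log 2) + 1 / (n : ℝ)) atTop
      (𝓝 (0 * (2 / Real.log 2) + 0)) := by
    refine Tendsto.add (Tendsto.mul_const _ ?_) tendsto_one_div_atTop_nhds_zero_nat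
    exact Real.isLittleO_log_id_atTop.tendsto_div_nhds_zero.comp tendsto_natCast_atTop_atTop
  rw [zero_mul, zero_add] at h1
  refine squeeze_zero' (Eventually.of_forall fun _ => by positivity) ?_ h1
  filter_upwards [eventually_ge_atTop 2] with n hn
  have hn0 : (0 : ℝ) < n := by exact_mod_cast (by omega : 0 < n)
  have h2 : 2 ^ (Nat.clog 2 (n + 1) - 1) < n + 1 :=
    Nat.pow_pred_clog_lt_self (by norm_num) (by omega)
  have h3 : 2 ^ (Nat.clog 2 (n + 1) - 1) ≤ n ^ 2 := by nlinarith
  have h4 : ((Nat.clog 2 (n + 1) - 1 : ℕ) : ℝ) * Real.log 2 ≤ 2 * Real.log n := by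
    have := Real.log_le_log (by positivity)
      (show ((2 : ℝ) ^ (Nat.clog 2 (n + 1) - 1)) ≤ (n : ℝ) ^ 2 by exact_mod_cast h3)
    rw [Real.log_pow, Real.log_pow] at this
    exact_mod_cast this
  have h5 : (Nat.clog 2 (n + 1) : ℝ) ≤ ((Nat.clog 2 (n + 1) - 1 : ℕ) : ℝ) + 1 := by
    exact_mod_cast (by omega : Nat.clog 2 (n + 1) ≤ Nat.clog 2 (n + 1) - 1 + 1)
  have hlog := Real.log_pos (one_lt_two : (1 : ℝ) < 2)
  rw [← le_div_iff₀ hlog] at h4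
  calc (Nat.clog 2 (n + 1) : ℝ) / n ≤ (2 * Real.log n / Real.log 2 + 1) / n := by
        gcongr; linarith
    _ = _ := by field_simp

variable {G : Type*} [Group G] {S : Set G}

theorem ncard_ball_pos (hS : Subgroup.closure S = ⊤) (hfin : S.Finite) (n : ℕ) :
    0 < (ball S n).ncard :=
  (Set.ncard_pos (finite_ball hS hfin n)).mpr ⟨1, mem_ball.mpr (by rw [wordNorm_one]; omega)⟩

/-- The exponential growth rate of the balls of a word metric is a limit. -/
theorem exists_tendsto_log_ncard_ball (hS : Subgroup.closure S = ⊤) (hfin : S.Finite) :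
    ∃ a, Tendsto (fun n : ℕ => Real.log (ball S n).ncard / n) atTop (𝓝 a) := by
  -- Fekete's lemma: a ball of radius `m + n` lies in the product of those of radii `m` and `n`.
  have hsub : Subadditive (fun n : ℕ => Real.log (ball S n).ncard) := by
    intro m n
    have h1 := ncard_ball_pos hS hfin m
    have h2 := ncard_ball_pos hS hfin n
    have h3 := ncard_ball_pos hS hfin (m + n)
    rw [← Real.log_mul (by positivity) (by positivity)]
    refine Real.log_le_log (by positivity) ?_
    have hm := finite_ball hS hfin m
    have hn := finite_ball hS hfin n
    have : (ball S (m + n)).ncard ≤ (ball S m).ncard * (ball S n).ncard := by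
      refine (Set.ncard_le_ncard (ball_add hS m n) (hm.image2 _ hn)).trans ?_
      rw [← Set.image_prod, ← Set.ncard_prod]
      exact Set.ncard_image_le (hm.prod hn)
    exact_mod_cast this
  refine ⟨_, hsub.tendsto_lim ⟨0, ?_⟩⟩
  rintro _ ⟨n, rfl⟩
  exact div_nonneg (Real.log_natCast_nonneg _) (Nat.cast_nonneg _)

theorem growthRate_eq_of_tendsto {A : Set G} {a : ℝ}
    (h : Tendsto (fun n : ℕ => Real.log (A ∩ ball S n).ncard / n) atTop (𝓝 a)) :
    growthRate S A = (a : EReal) := by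
  refine Tendsto.limsup_eq ?_
  refine (continuous_coe_real_ereal.tendsto a).comp (h.congr fun n => ?_)
  rw [one_div, div_eq_inv_mul]

end Growth
end WordHyp

/-! ### Squeezing the growth of the conjugacy class -/

open Filter Topology WordHyp in
theorem mainTheorem6 {Γ : Type*} [Group Γ]
    (hΓ : WordHyp.IsWordHyperbolic Γ) (hne : WordHyp.IsNonelementary Γ)
    (S : Set Γ) (hSfin : S.Finite) (hSgen : Subgroup.closure S = ⊤)
    (γ₀ : Γ) (hγ₀ : γ₀ ∉ WordHyp.virtualCenter Γ) :
    WordHyp.growthRate S (conjugatesOf γ₀) =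
      ((1 / 2 : ℝ) : EReal) * WordHyp.growthRate S Set.univ := by
  have hinf : (conjugatesOf γ₀).Infinite := hγ₀
  obtain ⟨T, hTfin, hT, δ, hδ⟩ := hΓ
  have h := isHyperbolicMetric_wordDist hT hTfin hδ
  obtain ⟨M, hM⟩ := exists_wordNorm_le_mul hSgen hT hTfin
  obtain ⟨M', hM'⟩ := exists_wordNorm_le_mul hT hSgen hSfin
  obtain ⟨A, hA⟩ := exists_ncard_conj_le (M := M) (M' := M') h hSgen hSfin
    (fun g => by simpa [wordDist] using mod_cast hM g)
    (fun g => by simpa [wordDist] using mod_cast hM' g)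
    (Nat.cast_nonneg _) (Nat.cast_nonneg _) γ₀
  obtain ⟨Q, R, hQ⟩ := exists_ncard_ball_le h hSgen hSfin hinf
  obtain ⟨a, ha⟩ := exists_tendsto_log_ncard_ball hSgen hSfin
  have hup := tendsto_comp_div_of_ratio ha
    (r := fun n => (n + A * (Nat.clog 2 (n + 1) + 1)) / 2)
    (e := fun n => A * (Nat.clog 2 (n + 1) + 1) + 1)
    (Eventually.of_forall fun n => by
      have h1 : 2 * ((n + A * (Nat.clog 2 (n + 1) + 1)) / 2) ≤
          n + (A * (Nat.clog 2 (n + 1) + 1) + 1) := by omega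
      have h2 : n ≤ 2 * ((n + A * (Nat.clog 2 (n + 1) + 1)) / 2) +
          (A * (Nat.clog 2 (n + 1) + 1) + 1) := by omega
      rw [abs_sub_le_iff]
      constructor
      · rw [sub_le_iff_le_add']; exact_mod_cast h1
      · rw [sub_le_iff_le_add']; exact_mod_cast h2)
    (by
      have := (tendsto_clog_div_atTop.const_mul (A : ℝ)).add
        (tendsto_one_div_atTop_nhds_zero_nat.const_mul ((A : ℝ) + 1))
      simp only [mul_zero, add_zero] at this
      refine this.congr fun n => ?_
      ring)
  -- Subtraction truncates for `n < R`, but the error bound `R + 1` still holds there.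
  have hlow := tendsto_comp_div_of_ratio ha (r := fun n => (n - R) / 2) (e := fun n => R + 1)
    (Eventually.of_forall fun n => by
      have h1 : 2 * ((n - R) / 2) ≤ n + (R + 1) := by omega
      have h2 : n ≤ 2 * ((n - R) / 2) + (R + 1) := by omega
      rw [abs_sub_le_iff]
      constructor
      · rw [sub_le_iff_le_add']; exact_mod_cast h1
      · rw [sub_le_iff_le_add']; exact_mod_cast h2)
    (tendsto_const_div_atTop_nhds_zero_nat _)
  have hlow' := hlow.sub (tendsto_const_div_atTop_nhds_zero_nat (Real.log Q))
  rw [sub_zero] at hlow'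
  have hK : Tendsto (fun n : ℕ => Real.log (conjugatesOf γ₀ ∩ ball S n).ncard / n) atTop
      (𝓝 (a * (1 / 2))) := by
    refine tendsto_of_tendsto_of_tendsto_of_le_of_le' hlow' hup ?_ ?_
    · filter_upwards [eventually_ge_atTop R] with n hn
      rw [← sub_div]
      refine div_le_div_of_nonneg_right ?_ (Nat.cast_nonneg _)
      rw [sub_le_iff_le_add]
      have hpos := ncard_ball_pos hSgen hSfin ((n - R) / 2)
      have hle : (ball S ((n - R) / 2)).ncard ≤ Q * (conjugatesOf γ₀ ∩ ball S n).ncard := by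
        refine (hQ _).trans (Nat.mul_le_mul_left _ (Set.ncard_le_ncard ?_
          ((finite_ball hSgen hSfin n).subset Set.inter_subset_right)))
        refine Set.inter_subset_inter_right _ fun g hg => ?_
        rw [mem_ball] at hg ⊢
        omega
      have hmul := mul_ne_zero_iff.mp (hpos.trans_le hle).ne'
      rw [add_comm, ← Real.log_mul (by exact_mod_cast hmul.1) (by exact_mod_cast hmul.2)]
      exact Real.log_le_log (by exact_mod_cast hpos) (by exact_mod_cast hle)
    · refine Eventually.of_forall fun n => ?_
      refine div_le_div_of_nonneg_right ?_ (Nat.cast_nonneg _)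
      -- For small `n` the intersection may be empty; then `Real.log 0 = 0` keeps the bound valid.
      rcases Nat.eq_zero_or_pos (conjugatesOf γ₀ ∩ ball S n).ncard with h0 | h0
      · rw [h0, Nat.cast_zero, Real.log_zero]
        exact Real.log_natCast_nonneg _
      · exact Real.log_le_log (by exact_mod_cast h0) (by exact_mod_cast hA n)
  have hU : Tendsto (fun n : ℕ => Real.log (Set.univ ∩ ball S n).ncard / n) atTop (𝓝 a) := by
    simpa only [Set.univ_inter] using ha
  rw [growthRate_eq_of_tendsto hK, growthRate_eq_of_tendsto hU, ← EReal.coe_mul, mul_comm]
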